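/- Let $X$ be a locally compact Hausdorff space with a countable base and let $G:X\times X\to[0,+\infty]$ be a lower semicontinuous (l.s.c.) symmetric kernel with $G(x,x)>0$ for all $x\in X$. For a positive Radon measure $\mu$ on $X$ write $G\mu(x)=\int G(x,y)\,d\mu(y)$, let $\mathcal E^+$ be the set of positive Radon measures $\mu$ of finite energy $\int G\mu\,d\mu<+\infty$, and let $\mathcal E^+_1=\{\mu:\int G\mu\,d\mu\le1\}$. For $\varphi:X\to[0,+\infty[$ continuous with compact support put $c(\varphi)=\sup_{\mu\in\mathcal E_1^+}\int\varphi\,d\mu$; for l.s.c. $g:X\to[0,+\infty]$ put $c(g)=\sup\{c(\varphi):\varphi\le g\}$ with $\varphi$ as before; for arbitrary $f:X\to[0,+\infty]$ put $c^*(f)=\inf\{c(g):g\text{ l.s.c.},\ g\ge f\}$; and $c^*(A)=c^*(1_A)$ for $A\subset X$. A property holds quasi-everywhere (q.e.) if it holds off a set $E$ with $c^*(E)=0$. A function $f:X\to[0,+\infty]$ is quasi u.s.c. if for every $\varepsilon>0$ there is $V\subset X$ with $c^*(V)<\varepsilon$ such that $f|_{X\setminus V}$ is upper semicontinuous. Assume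 that: (1) $G$ is consistent: for every $\lambda\in\mathcal E^+$ and $\varepsilon>0$ there is a finite upper semicontinuous function $h\ge0$ of compact support with $c^*(|G\lambda-h|)<\varepsilon$; (2) $G$ is positive definite: $2\int G\mu\,d\nu\le\int G\mu\,d\mu+\int G\nu\,d\nu$ for all $\mu,\nu\in\mathcal E^+$; (3) $G$ satisfies the domination principle: if $\mu,\omega\in\mathcal E^+$ and $G\mu\le G\omega$ $\mu$-a.e., then $G\mu\le G\omega$ everywhere on $X$. Write $\widehat f$ for the greatest l.s.c. minorant of $f:X\to[0,+\infty]$. Then for any nonempty family $(\mu_\alpha)\subset\mathcal E^+$ there exists $\mu\in\mathcal E^+$ such that $$G\mu\ \le\ \widehat{\inf_\alpha G\mu_\alpha}\ \le\ \inf_\alpha G\mu_\alpha\ \text{ everywhere on }X\qquad\text{and}\qquad \inf_\alpha G\mu_\alpha\ \le\ G\mu\ \text{ q.e.}$$ In particular, $\inf_\alpha G\mu_\alpha$ is quasi u.s.c. and is equal q.e. to $\widehat{\inf_\alpha G\mu_\alpha}$. -/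

import Mathlib

open MeasureTheory
open scoped ENNReal

noncomputable section

namespace EnergyKernel

variable {X : Type*} [TopologicalSpace X]

/-- The greatest lower semicontinuous minorant of `f : X → [0,+∞]`. -/
def lscReg (f : X → ℝ≥0∞) (x : X) : ℝ≥0∞ :=
  ⨆ (g : X → ℝ≥0∞) (_ : LowerSemicontinuous g ∧ g ≤ f), g x

theorem lowerSemicontinuous_lscReg (f : X → ℝ≥0∞) : LowerSemicontinuous (lscReg f) :=
  lowerSemicontinuous_iSup fun _ => lowerSemicontinuous_iSup fun hg => hg.1

theorem lscReg_le (f : X → ℝ≥0∞) : lscReg f ≤ f :=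
  fun x => iSup₂_le fun _ hg => hg.2 x

theorem le_lscReg {f g : X → ℝ≥0∞} (hg : LowerSemicontinuous g) (hgf : g ≤ f) :
    g ≤ lscReg f :=
  fun x => le_iSup₂ (f := fun (k : X → ℝ≥0∞) (_ : LowerSemicontinuous k ∧ k ≤ f) => k x)
    g ⟨hg, hgf⟩

/-- Finite continuous functions `X → [0,+∞[` of compact support. -/
def contCompact (X : Type*) [TopologicalSpace X] : Set (X → ℝ≥0∞) :=
  {φ | Continuous φ ∧ (∀ x, φ x ≠ ∞) ∧ HasCompactSupport φ}

/-- Finite upper semicontinuous functions `X → [0,+∞[` of compact support. -/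
def uscCompact (X : Type*) [TopologicalSpace X] : Set (X → ℝ≥0∞) :=
  {h | UpperSemicontinuous h ∧ (∀ x, h x ≠ ∞) ∧ HasCompactSupport h}

/-- A kernel on `X`: a lower semicontinuous function `X × X → [0,+∞]`, here symmetric and
strictly positive on the diagonal. -/
structure IsKernel (G : X → X → ℝ≥0∞) : Prop where
  lsc : LowerSemicontinuous fun p : X × X => G p.1 p.2
  symm : ∀ x y, G x y = G y x
  diag_pos : ∀ x, 0 < G x x

variable [MeasurableSpace X]

/-- The potential `Gμ(x) = ∫ G(x,y) dμ(y)`. -/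
def potential (G : X → X → ℝ≥0∞) (μ : Measure X) (x : X) : ℝ≥0∞ :=
  ∫⁻ y, G x y ∂μ

/-- The energy `∫ Gμ dμ`. -/
def energy (G : X → X → ℝ≥0∞) (μ : Measure X) : ℝ≥0∞ :=
  ∫⁻ x, potential G μ x ∂μ

/-- The cone of positive Radon measures of finite energy. -/
def finiteEnergy [BorelSpace X] (G : X → X → ℝ≥0∞) : Set (Measure X) :=
  {μ | μ.Regular ∧ energy G μ < ∞}

/-- The set of positive Radon measures of energy at most one. -/
def energyUnitBall [BorelSpace X] (G : X → X → ℝ≥0∞) : Set (Measure X) :=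
  {μ | μ.Regular ∧ energy G μ ≤ 1}

variable [BorelSpace X]

/-- The energy capacity of a function, meant for finite continuous functions of compact
support. -/
def capCont (G : X → X → ℝ≥0∞) (φ : X → ℝ≥0∞) : ℝ≥0∞ :=
  ⨆ μ ∈ energyUnitBall G, ∫⁻ x, φ x ∂μ

/-- The energy capacity of a lower semicontinuous function. -/
def capLsc (G : X → X → ℝ≥0∞) (g : X → ℝ≥0∞) : ℝ≥0∞ :=
  ⨆ (φ : X → ℝ≥0∞) (_ : φ ∈ contCompact X ∧ φ ≤ g), capCont G φ

/-- The upper energy capacity of an arbitrary function `X → [0,+∞]`. -/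
def upperCap (G : X → X → ℝ≥0∞) (f : X → ℝ≥0∞) : ℝ≥0∞ :=
  ⨅ (g : X → ℝ≥0∞) (_ : LowerSemicontinuous g ∧ f ≤ g), capLsc G g

/-- The outer energy capacity of an arbitrary set. -/
def outerCap (G : X → X → ℝ≥0∞) (A : Set X) : ℝ≥0∞ :=
  upperCap G (A.indicator fun _ => 1)

/-- `P` holds quasi-everywhere: off a set of zero outer energy capacity. -/
def QuasiEverywhere (G : X → X → ℝ≥0∞) (P : X → Prop) : Prop :=
  outerCap G {x | ¬ P x} = 0

/-- Quasi upper semicontinuity with respect to the outer energy capacity. -/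
def QuasiUSC (G : X → X → ℝ≥0∞) (f : X → ℝ≥0∞) : Prop :=
  ∀ ε : ℝ≥0∞, 0 < ε → ∃ V : Set X, outerCap G V < ε ∧ UpperSemicontinuousOn f Vᶜ

/-- The closure of `uscCompact X` for the pseudometric `(f₁, f₂) ↦ upperCap G |f₁ - f₂|`. The
subtraction is truncated and `h` is finite, so the maximum below is `|f - h|`. -/
def uscCompactClosure (G : X → X → ℝ≥0∞) : Set (X → ℝ≥0∞) :=
  {f | ∀ ε : ℝ≥0∞, 0 < ε →
    ∃ h ∈ uscCompact X, upperCap G (fun x => max (f x - h x) (h x - f x)) < ε}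

/-- Consistency: every potential of a measure of finite energy is in `uscCompactClosure G`. -/
def IsConsistent (G : X → X → ℝ≥0∞) : Prop :=
  ∀ μ ∈ finiteEnergy G, potential G μ ∈ uscCompactClosure G

/-- Positive (semi)definiteness: `2 ∫ Gμ dν ≤ ∫ Gμ dμ + ∫ Gν dν` on measures of finite energy. -/
def IsPosDef (G : X → X → ℝ≥0∞) : Prop :=
  ∀ μ ∈ finiteEnergy G, ∀ ν ∈ finiteEnergy G,
    2 * ∫⁻ x, potential G μ x ∂ν ≤ energy G μ + energy G ν

/-- The domination principle. -/
def DominationPrinciple (G : X → X → ℝ≥0∞) : Prop :=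
  ∀ ω ∈ finiteEnergy G, ∀ μ ∈ finiteEnergy G,
    (∀ᵐ x ∂μ, potential G μ x ≤ potential G ω x) →
      ∀ x, potential G μ x ≤ potential G ω x

end EnergyKernel

end

open EnergyKernel

/-! The lower envelope is represented by a capacitary extremal measure. Potentials are l.s.c., so
Choquet's lemma replaces the family by a sequence with the same l.s.c. minorants. Let `f n` be the
minimum of the first potentials of that sequence and `f` the decreasing limit.

Consistency puts each `f n` in the closure of the compactly supported u.s.c. functions, where `σ ↦ ∫
f n dσ` is vaguely u.s.c. on the energy unit ball. The ball is vaguely compact by positivity of `G`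
on the diagonal and positive definiteness. Hence the capacity `c` of `f` is attained as `∫ f dμ`
with `μ` in the ball (`exists_upperCap_iInf_le`).

The first variation at `μ` gives `∫ f dσ ≤ c ∫ Gμ dσ` for every `σ` in the ball
(`lintegral_le_mul_lintegral_potential`). Applied to restrictions of `σ`, it yields `f ≤ G(cμ)`
almost everywhere for each such `σ`, with equality `μ`-a.e. because `∫ c Gμ dμ ≤ c`. The equality
and the domination principle give `G(cμ) ≤ f` everywhere. Attainment of capacity for the functions
`f n - G(cμ)` turns the almost everywhere inequalities into `f ≤ G(cμ)` q.e.
(`quasiEverywhere_iInf_le`). -/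

namespace EnergyKernel

open Filter Topology Set
open scoped NNReal CompactlySupported

set_option linter.unusedSectionVars false

/-! ### Approximation of semicontinuous functions and Choquet's lemma. -/

section Approximation

variable {X : Type*} [TopologicalSpace X]

theorem zero_mem_contCompact : (0 : X → ℝ≥0∞) ∈ contCompact X :=
  ⟨continuous_const, fun _ => ENNReal.zero_ne_top, HasCompactSupport.zero⟩

theorem sup_mem_contCompact {φ ψ : X → ℝ≥0∞} (hφ : φ ∈ contCompact X) (hψ : ψ ∈ contCompact X) :
    φ ⊔ ψ ∈ contCompact X :=
  ⟨hφ.1.sup hψ.1, fun x => by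
    simpa only [Pi.sup_apply] using (max_lt (hφ.2.1 x).lt_top (hψ.2.1 x).lt_top).ne,
    HasCompactSupport.comp₂_left (m := (· ⊔ ·)) hφ.2.2 hψ.2.2 (by simp)⟩

theorem exists_contCompact_one_of_isCompact [T2Space X] [LocallyCompactSpace X] {K U : Set X}
    (hK : IsCompact K) (hU : IsOpen U) (hKU : K ⊆ U) :
    ∃ χ ∈ contCompact X, (∀ x ∈ K, χ x = 1) ∧ (∀ x ∉ U, χ x = 0) ∧ ∀ x, χ x ≤ 1 := by
  obtain ⟨f, hf1, hf0, hfs, hf⟩ := exists_continuous_one_zero_of_isCompact hK hU.isClosed_compl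
    (disjoint_compl_right_iff_subset.2 hKU)
  refine ⟨fun x => ENNReal.ofReal (f x),
    ⟨ENNReal.continuous_ofReal.comp f.continuous, fun x => ENNReal.ofReal_ne_top,
      hfs.comp_left ENNReal.ofReal_zero⟩, fun x hx => ?_, fun x hx => ?_, fun x => ?_⟩
  · simp [hf1 hx]
  · simp [hf0 hx]
  · exact ENNReal.ofReal_le_one.2 (hf x).2

theorem const_mul_mem_contCompact {φ : X → ℝ≥0∞} (hφ : φ ∈ contCompact X) (r : ℝ≥0) :
    (fun x => (r : ℝ≥0∞) * φ x) ∈ contCompact X :=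
  ⟨ENNReal.continuous_const_mul ENNReal.coe_ne_top |>.comp hφ.1,
    fun x => ENNReal.mul_ne_top ENNReal.coe_ne_top (hφ.2.1 x),
    hφ.2.2.comp_left (mul_zero _)⟩

theorem exists_mem_contCompact_lt [T2Space X] [LocallyCompactSpace X] {g : X → ℝ≥0∞}
    (hg : LowerSemicontinuous g) {x : X} {a : ℝ≥0∞} (ha : a < g x) :
    ∃ φ ∈ contCompact X, φ ≤ g ∧ a < φ x := by
  obtain ⟨r, har, hrg⟩ := ENNReal.lt_iff_exists_nnreal_btwn.1 ha
  obtain ⟨χ, hχ, h1, h0, hle⟩ := exists_contCompact_one_of_isCompact (isCompact_singleton (x := x))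
    (hg.isOpen_preimage r) (singleton_subset_iff.2 hrg)
  refine ⟨_, const_mul_mem_contCompact hχ r, fun y => ?_, by simpa [h1 x rfl] using har⟩
  by_cases hy : (r : ℝ≥0∞) < g y
  · exact (mul_le_of_le_one_right' (hle y)).trans hy.le
  · simp [h0 y hy]

/-- On a second countable locally compact Hausdorff space, every lower semicontinuous function
`X → [0,+∞]` is the supremum of an increasing sequence of continuous functions of compact
support. -/
theorem exists_monotone_contCompact_iSup_eq [T2Space X] [LocallyCompactSpace X]
    [SecondCountableTopology X] {g : X → ℝ≥0∞} (hg : LowerSemicontinuous g) :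
    ∃ φ : ℕ → X → ℝ≥0∞, (∀ n, φ n ∈ contCompact X) ∧ Monotone φ ∧ ∀ x, ⨆ n, φ n x = g x := by
  let B := TopologicalSpace.countableBasis X
  have hB := TopologicalSpace.isBasis_countableBasis X
  have hBc : Countable B := (TopologicalSpace.countable_countableBasis X).to_subtype
  let P : B × ℚ → (X → ℝ≥0∞) → Prop := fun p φ =>
    φ ∈ contCompact X ∧ φ ≤ g ∧ ∀ y ∈ (p.1 : Set X), (Real.toNNReal p.2 : ℝ≥0∞) < φ y
  classical
  -- For each basic open set and rational level, one minorant of `g` exceeding the level there is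
  -- chosen when it exists. The extra index `none` keeps the index type nonempty even for empty `X`.
  let e : Option (B × ℚ) → X → ℝ≥0∞ := fun o =>
    o.elim 0 fun p => if h : ∃ φ, P p φ then h.choose else 0
  have he : ∀ o, e o ∈ contCompact X ∧ e o ≤ g := by
    rintro (_ | p)
    · exact ⟨zero_mem_contCompact, fun _ => zero_le⟩
    · by_cases h : ∃ φ, P p φ
      · simp only [e, Option.elim, dif_pos h]
        exact ⟨h.choose_spec.1, h.choose_spec.2.1⟩
      · simp only [e, Option.elim, dif_neg h]
        exact ⟨zero_mem_contCompact, fun _ => zero_le⟩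
  obtain ⟨u, hu⟩ := exists_surjective_nat (Option (B × ℚ))
  have hmem : ∀ n, partialSups (e ∘ u) n ∈ contCompact X := by
    intro n
    induction n with
    | zero => simpa using (he _).1
    | succ n ih =>
      rw [partialSups_add_one]
      exact sup_mem_contCompact ih (he _).1
  refine ⟨fun n => partialSups (e ∘ u) n, hmem, (partialSups (e ∘ u)).monotone, fun x => ?_⟩
  apply le_antisymm
  · refine iSup_le fun n => ?_
    exact partialSups_le (e ∘ u) n g (fun k _ => (he _).2) x
  · refine le_of_forall_lt fun a ha => ?_
    obtain ⟨q, -, haq, hqg⟩ := ENNReal.lt_iff_exists_rat_btwn.1 ha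
    obtain ⟨φ, hφ, hφg, hqφ⟩ := exists_mem_contCompact_lt hg hqg
    obtain ⟨b, hb, hxb, hbs⟩ := hB.exists_subset_of_mem_open (a := x)
      (u := {y | (Real.toNNReal q : ℝ≥0∞) < φ y}) hqφ (isOpen_lt continuous_const hφ.1)
    have h : ∃ φ, P (⟨b, hb⟩, q) φ := ⟨φ, hφ, hφg, fun y hy => hbs hy⟩
    obtain ⟨n, hn⟩ := hu (some (⟨b, hb⟩, q))
    have h1 : (Real.toNNReal q : ℝ≥0∞) < e (u n) x := by
      rw [hn]
      simp only [e, Option.elim, dif_pos h]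
      exact h.choose_spec.2.2 x hxb
    exact haq.trans (h1.trans_le ((le_partialSups (e ∘ u) n x).trans
      (le_iSup (fun n => partialSups (e ∘ u) n x) n)))

theorem lowerSemicontinuous_tsub {u v : X → ℝ≥0∞} (hu : LowerSemicontinuous u)
    (hv : UpperSemicontinuous v) : LowerSemicontinuous fun x => u x - v x := by
  intro x a ha
  have ha' : a + v x < u x := lt_tsub_iff_right.1 ha
  obtain ⟨r, h1, h2⟩ := exists_between ha'
  have hav : UpperSemicontinuous fun y => a + v y := upperSemicontinuous_const.add hv
  filter_upwards [hav x r h1, hu x r h2] with y hy1 hy2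
  exact lt_tsub_iff_right.2 (hy1.trans hy2)

theorem tsub_mem_uscCompact {h g : X → ℝ≥0∞} (hh : h ∈ uscCompact X)
    (hg : LowerSemicontinuous g) : (fun x => h x - g x) ∈ uscCompact X := by
  refine ⟨fun x a ha => ?_, fun x => ((tsub_le_self).trans_lt (hh.2.1 x).lt_top).ne,
    hh.2.2.mono fun x hx hx0 => hx (by simp [hx0])⟩
  -- The condition `0 < a` is needed because truncated subtraction is never below `0`, while `h y <
  -- g y` may hold.
  have key : ∀ y, h y - g y < a ↔ 0 < a ∧ h y < a + g y := by
    intro y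
    rcases le_total (g y) (h y) with hle | hle
    · rw [ENNReal.sub_lt_iff_lt_right (ne_top_of_le_ne_top (hh.2.1 y) hle) hle]
      refine ⟨fun H => ⟨?_, H⟩, fun H => H.2⟩
      rcases eq_or_ne a 0 with rfl | h0
      · simp [hle.not_gt] at H
      · exact pos_iff_ne_zero.2 h0
    · rw [tsub_eq_zero_of_le hle]
      refine ⟨fun H => ⟨H, ?_⟩, fun H => H.1⟩
      rcases eq_or_ne (g y) ∞ with h1 | h1
      · simpa [h1] using (hh.2.1 y).lt_top
      · exact hle.trans_lt (by rw [add_comm]; exact ENNReal.lt_add_right h1 H.ne')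
  have ha' := (key x).1 ha
  obtain ⟨r, h1, h2⟩ := exists_between ha'.2
  have hag : LowerSemicontinuous fun y => a + g y := lowerSemicontinuous_const.add hg
  filter_upwards [hh.1 x r h1, hag x r h2] with y hy1 hy2
  exact (key y).2 ⟨ha'.1, hy1.trans hy2⟩

theorem inf_mem_uscCompact {h k : X → ℝ≥0∞} (hh : h ∈ uscCompact X) (hk : k ∈ uscCompact X) :
    (fun x => min (h x) (k x)) ∈ uscCompact X :=
  ⟨hh.1.inf hk.1, fun x => ((min_le_left _ _).trans_lt (hh.2.1 x).lt_top).ne,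
    HasCompactSupport.comp₂_left (m := min) hh.2.2 hk.2.2 (by simp)⟩

theorem contCompact_subset_uscCompact : contCompact X ⊆ uscCompact X :=
  fun _ h => ⟨h.1.upperSemicontinuous, h.2.1, h.2.2⟩

theorem exists_forall_le_of_mem_uscCompact {h : X → ℝ≥0∞} (hh : h ∈ uscCompact X) :
    ∃ M : ℝ≥0, ∀ x, h x ≤ M := by
  rcases (tsupport h).eq_empty_or_nonempty with he | hne
  · exact ⟨0, fun x => by simp [image_eq_zero_of_notMem_tsupport (f := h) (x := x) (by simp [he])]⟩
  · obtain ⟨a, -, ha⟩ := (hh.1.upperSemicontinuousOn _).exists_isMaxOn hne hh.2.2.isCompact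
    refine ⟨(h a).toNNReal, fun x => ?_⟩
    rw [ENNReal.coe_toNNReal (hh.2.1 a)]
    by_cases hx : x ∈ tsupport h
    · exact ha hx
    · simp [image_eq_zero_of_notMem_tsupport hx]

theorem exists_contCompact_ge [T2Space X] [LocallyCompactSpace X] {h : X → ℝ≥0∞}
    (hh : h ∈ uscCompact X) : ∃ φ ∈ contCompact X, h ≤ φ := by
  obtain ⟨χ, hχ, h1, -, -⟩ := exists_contCompact_one_of_isCompact hh.2.2.isCompact isOpen_univ
    (subset_univ _)
  obtain ⟨M, hM⟩ := exists_forall_le_of_mem_uscCompact hh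
  refine ⟨_, const_mul_mem_contCompact hχ M, fun x => ?_⟩
  by_cases hx : x ∈ tsupport h
  · simpa [h1 x hx] using hM x
  · simp [image_eq_zero_of_notMem_tsupport hx]

theorem tsub_mem_contCompact {φ ψ : X → ℝ≥0∞} (hφ : φ ∈ contCompact X) (hψ : ψ ∈ contCompact X) :
    (fun x => φ x - ψ x) ∈ contCompact X :=
  ⟨by
    rw [continuous_iff_continuousAt]
    exact fun x => ENNReal.Tendsto.sub hφ.1.continuousAt hψ.1.continuousAt (Or.inl (hφ.2.1 x)),
    fun x => ((tsub_le_self).trans_lt (hφ.2.1 x).lt_top).ne,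
    HasCompactSupport.comp₂_left (m := fun a b : ℝ≥0∞ => a - b) hφ.2.2 hψ.2.2 (by simp)⟩

/-- For a continuous majorant `φ` of `h`, the function `φ - h` is l.s.c.; its increasing
approximants are subtracted from `φ`. -/
theorem exists_antitone_contCompact_iInf_eq [T2Space X] [LocallyCompactSpace X]
    [SecondCountableTopology X] {h : X → ℝ≥0∞} (hh : h ∈ uscCompact X) :
    ∃ φ : ℕ → X → ℝ≥0∞, (∀ n, φ n ∈ contCompact X) ∧ Antitone φ ∧ ∀ x, ⨅ n, φ n x = h x := by
  obtain ⟨φ, hφ, hle⟩ := exists_contCompact_ge hh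
  obtain ⟨ψ, hψ, hmono, hsup⟩ := exists_monotone_contCompact_iSup_eq
    (lowerSemicontinuous_tsub hφ.1.lowerSemicontinuous hh.1)
  refine ⟨fun n x => φ x - ψ n x, fun n => tsub_mem_contCompact hφ (hψ n),
    fun m n hmn x => tsub_le_tsub_left (hmono hmn x) _, fun x => ?_⟩
  rw [← ENNReal.sub_iSup (hφ.2.1 x), hsup, ENNReal.sub_sub_cancel (hφ.2.1 x) (hle x)]

/-- A form of Choquet's topological lemma: some countable subfamily has the same lower
semicontinuous minorants as the whole family. -/
theorem exists_seq_lowerSemicontinuous_le [SecondCountableTopology X] {ι : Type*} [Nonempty ι]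
    (u : ι → X → ℝ≥0∞) :
    ∃ s : ℕ → ι, ∀ g : X → ℝ≥0∞, LowerSemicontinuous g → (∀ n, g ≤ u (s n)) → ∀ i, g ≤ u i := by
  let B := TopologicalSpace.countableBasis X
  have hB := TopologicalSpace.isBasis_countableBasis X
  have hBc : Countable B := (TopologicalSpace.countable_countableBasis X).to_subtype
  let P : B × ℚ → ι → Prop := fun p i => ∃ y ∈ (p.1 : Set X), u i y < (Real.toNNReal p.2 : ℝ≥0∞)
  classical
  -- Whenever some member falls below level `q` somewhere in a basic set, one such member is
  -- selected. If `u i x < q < g x`, then `g > q` on a basic neighbourhood of `x`, which the member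
  -- selected for it contradicts.
  let e : Option (B × ℚ) → ι := fun o =>
    o.elim (Classical.arbitrary ι) fun p => if h : ∃ i, P p i then h.choose else Classical.arbitrary ι
  obtain ⟨v, hv⟩ := exists_surjective_nat (Option (B × ℚ))
  refine ⟨e ∘ v, fun g hg hle i x => ?_⟩
  by_contra! hlt
  obtain ⟨q, -, h1, h2⟩ := ENNReal.lt_iff_exists_rat_btwn.1 hlt
  obtain ⟨b, hb, hxb, hbs⟩ := hB.exists_subset_of_mem_open (a := x)
    (u := g ⁻¹' Ioi (Real.toNNReal q : ℝ≥0∞)) h2 (hg.isOpen_preimage _)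
  have h : ∃ i, P (⟨b, hb⟩, q) i := ⟨i, x, hxb, h1⟩
  obtain ⟨n, hn⟩ := hv (some (⟨b, hb⟩, q))
  have hen : (e ∘ v) n = h.choose := by
    simp only [Function.comp, hn, e, Option.elim, dif_pos h]
  obtain ⟨y, hy, hyq⟩ := h.choose_spec
  have := hle n y
  rw [hen] at this
  exact (this.trans_lt hyq).not_gt (hbs hy)

end Approximation

/-! ### Potentials, energy, and subadditivity of the capacity. -/

section Capacity

variable {X : Type*} [TopologicalSpace X] [T2Space X] [LocallyCompactSpace X]
  [SecondCountableTopology X] [MeasurableSpace X] [BorelSpace X] {G : X → X → ℝ≥0∞}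

theorem IsKernel.measurable (hG : IsKernel G) : Measurable (Function.uncurry G) :=
  hG.lsc.measurable

theorem IsKernel.lowerSemicontinuous_left (hG : IsKernel G) (y : X) :
    LowerSemicontinuous fun x => G x y :=
  fun x a ha => (by fun_prop : Continuous fun z : X => (z, y)).continuousAt.eventually
    (hG.lsc (x, y) a ha)

theorem IsKernel.measurable_right (hG : IsKernel G) (x : X) : Measurable (G x) :=
  hG.measurable.comp measurable_prodMk_left

theorem IsKernel.lowerSemicontinuous_potential (hG : IsKernel G) (μ : Measure X) :
    LowerSemicontinuous (potential G μ) := by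
  rw [lowerSemicontinuous_iff_le_liminf]
  intro x
  calc potential G μ x ≤ ∫⁻ y, liminf (fun z => G z y) (𝓝 x) ∂μ :=
        lintegral_mono fun y => (hG.lowerSemicontinuous_left y).le_liminf x
    _ ≤ liminf (fun z => ∫⁻ y, G z y ∂μ) (𝓝 x) :=
        lintegral_liminf_le fun z => hG.measurable_right z

theorem IsKernel.measurable_potential (hG : IsKernel G) (μ : Measure X) :
    Measurable (potential G μ) :=
  (hG.lowerSemicontinuous_potential μ).measurable

theorem IsKernel.lintegral_potential_comm (hG : IsKernel G) (μ ν : Measure X) [SFinite μ]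
    [SFinite ν] : ∫⁻ x, potential G μ x ∂ν = ∫⁻ x, potential G ν x ∂μ := by
  unfold potential
  rw [lintegral_lintegral_swap hG.measurable.aemeasurable]
  simp_rw [hG.symm]

theorem potential_smul (c : ℝ≥0) (μ : Measure X) (x : X) :
    potential G (c • μ) x = c * potential G μ x := by
  unfold potential
  rw [lintegral_smul_measure]; rfl

theorem potential_add (μ ν : Measure X) (x : X) :
    potential G (μ + ν) x = potential G μ x + potential G ν x :=
  lintegral_add_measure _ _ _

theorem energy_smul (c : ℝ≥0) (μ : Measure X) : energy G (c • μ) = c ^ 2 * energy G μ := by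
  unfold energy
  simp_rw [potential_smul]
  rw [lintegral_smul_measure, lintegral_const_mul' _ _ ENNReal.coe_ne_top, ENNReal.smul_def,
    smul_eq_mul, ← mul_assoc, sq]

theorem IsKernel.energy_add_smul (hG : IsKernel G) (μ σ : Measure X) [SFinite μ] [SFinite σ]
    (t : ℝ≥0) :
    energy G (μ + t • σ) =
      energy G μ + 2 * t * ∫⁻ x, potential G μ x ∂σ + t ^ 2 * energy G σ := by
  have h := hG.lintegral_potential_comm μ σ
  unfold energy
  simp_rw [potential_add, potential_smul]
  rw [lintegral_add_left (hG.measurable_potential μ), lintegral_add_measure, lintegral_add_measure,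
    lintegral_smul_measure, lintegral_const_mul' _ _ ENNReal.coe_ne_top,
    lintegral_const_mul' _ _ ENNReal.coe_ne_top, lintegral_smul_measure, ← h]
  simp only [ENNReal.smul_def, smul_eq_mul]
  ring

theorem energy_mono {μ ν : Measure X} (h : μ ≤ ν) : energy G μ ≤ energy G ν :=
  lintegral_mono' h fun _ => lintegral_mono' h le_rfl

theorem regular_of_le {μ ν : Measure X} [ν.Regular] (h : μ ≤ ν) : μ.Regular := by
  have : IsFiniteMeasureOnCompacts μ := ⟨fun K hK => (h K).trans_lt hK.measure_lt_top⟩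
  infer_instance

theorem mem_finiteEnergy_of_mem_energyUnitBall {μ : Measure X} (hμ : μ ∈ energyUnitBall G) :
    μ ∈ finiteEnergy G :=
  ⟨hμ.1, hμ.2.trans_lt ENNReal.one_lt_top⟩

theorem restrict_mem_energyUnitBall {μ : Measure X} (hμ : μ ∈ energyUnitBall G) (A : Set X) :
    μ.restrict A ∈ energyUnitBall G :=
  have := hμ.1
  ⟨regular_of_le Measure.restrict_le_self, (energy_mono Measure.restrict_le_self).trans hμ.2⟩

theorem zero_mem_energyUnitBall : (0 : Measure X) ∈ energyUnitBall G :=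
  ⟨inferInstance, by simp [energy]⟩

theorem IsPosDef.lintegral_potential_le_one (hpos : IsPosDef G) {μ ν : Measure X}
    (hμ : μ ∈ energyUnitBall G) (hν : ν ∈ energyUnitBall G) : ∫⁻ x, potential G μ x ∂ν ≤ 1 := by
  have h := (hpos μ (mem_finiteEnergy_of_mem_energyUnitBall hμ) ν
    (mem_finiteEnergy_of_mem_energyUnitBall hν)).trans (add_le_add hμ.2 hν.2)
  rw [one_add_one_eq_two] at h
  exact (ENNReal.mul_le_mul_iff_right two_ne_zero ENNReal.ofNat_ne_top).1 (by simpa using h)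

theorem IsPosDef.lintegral_potential_lt_top (hpos : IsPosDef G) {μ ν : Measure X}
    (hμ : μ ∈ finiteEnergy G) (hν : ν ∈ finiteEnergy G) : ∫⁻ x, potential G μ x ∂ν < ∞ := by
  have h := (hpos μ hμ ν hν).trans_lt (ENNReal.add_lt_top.2 ⟨hμ.2, hν.2⟩)
  by_contra! htop
  rw [top_le_iff] at htop
  simp [htop] at h

/-- The capacity of a lower semicontinuous function is its support functional on the energy unit
ball. -/
theorem capLsc_eq {g : X → ℝ≥0∞} (hg : LowerSemicontinuous g) :
    capLsc G g = ⨆ μ ∈ energyUnitBall G, ∫⁻ x, g x ∂μ := by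
  apply le_antisymm
  · exact iSup₂_le fun φ hφ => iSup₂_mono fun μ _ => lintegral_mono hφ.2
  · refine iSup₂_le fun μ hμ => ?_
    obtain ⟨φ, hφ, hmono, hsup⟩ := exists_monotone_contCompact_iSup_eq hg
    simp_rw [← hsup]
    rw [lintegral_iSup (fun n => (hφ n).1.measurable) hmono]
    refine iSup_le fun n => ?_
    exact le_iSup₂_of_le (φ n) ⟨hφ n, fun x => (le_iSup (fun n => φ n x) n).trans_eq (hsup x)⟩
      (le_iSup₂ (f := fun (μ : Measure X) (_ : μ ∈ energyUnitBall G) => ∫⁻ x, φ n x ∂μ) μ hμ)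

theorem lintegral_le_capLsc {g : X → ℝ≥0∞} (hg : LowerSemicontinuous g) {μ : Measure X}
    (hμ : μ ∈ energyUnitBall G) : ∫⁻ x, g x ∂μ ≤ capLsc G g := by
  rw [capLsc_eq hg]
  exact le_iSup₂ (f := fun (μ : Measure X) (_ : μ ∈ energyUnitBall G) => ∫⁻ x, g x ∂μ) μ hμ

theorem capLsc_le {g : X → ℝ≥0∞} (hg : LowerSemicontinuous g) {a : ℝ≥0∞}
    (h : ∀ μ ∈ energyUnitBall G, ∫⁻ x, g x ∂μ ≤ a) : capLsc G g ≤ a := by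
  rw [capLsc_eq hg]
  exact iSup₂_le h

theorem capLsc_add_le {g k : X → ℝ≥0∞} (hg : LowerSemicontinuous g) (hk : LowerSemicontinuous k) :
    capLsc G (fun x => g x + k x) ≤ capLsc G g + capLsc G k :=
  capLsc_le (hg.add hk) fun μ hμ => by
    rw [lintegral_add_left hg.measurable]
    exact add_le_add (lintegral_le_capLsc hg hμ) (lintegral_le_capLsc hk hμ)

theorem capLsc_tsum_le {g : ℕ → X → ℝ≥0∞} (hg : ∀ n, LowerSemicontinuous (g n)) :
    capLsc G (fun x => ∑' n, g n x) ≤ ∑' n, capLsc G (g n) :=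
  capLsc_le (lowerSemicontinuous_tsum hg) fun μ hμ => by
    rw [lintegral_tsum fun n => (hg n).measurable.aemeasurable]
    exact ENNReal.tsum_le_tsum fun n => lintegral_le_capLsc (hg n) hμ

theorem upperCap_le_capLsc {f g : X → ℝ≥0∞} (hg : LowerSemicontinuous g) (hfg : f ≤ g) :
    upperCap G f ≤ capLsc G g :=
  iInf₂_le g ⟨hg, hfg⟩

theorem exists_capLsc_lt {f : X → ℝ≥0∞} {a : ℝ≥0∞} (h : upperCap G f < a) :
    ∃ g : X → ℝ≥0∞, LowerSemicontinuous g ∧ f ≤ g ∧ capLsc G g < a := by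
  obtain ⟨g, hg⟩ := iInf_lt_iff.1 h
  obtain ⟨⟨h1, h2⟩, h3⟩ := iInf_lt_iff.1 hg
  exact ⟨g, h1, h2, h3⟩

theorem upperCap_mono {f k : X → ℝ≥0∞} (h : f ≤ k) : upperCap G f ≤ upperCap G k :=
  le_iInf₂ fun _ hg => upperCap_le_capLsc hg.1 (h.trans hg.2)

theorem lintegral_le_upperCap (f : X → ℝ≥0∞) {μ : Measure X} (hμ : μ ∈ energyUnitBall G) :
    ∫⁻ x, f x ∂μ ≤ upperCap G f :=
  le_iInf₂ fun _ hg => (lintegral_mono hg.2).trans (lintegral_le_capLsc hg.1 hμ)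

theorem outerCap_mono {A B : Set X} (h : A ⊆ B) : outerCap G A ≤ outerCap G B :=
  upperCap_mono (indicator_le_indicator_of_subset h fun _ => zero_le)

theorem outerCap_iUnion_le (A : ℕ → Set X) : outerCap G (⋃ n, A n) ≤ ∑' n, outerCap G (A n) := by
  refine ENNReal.le_of_forall_pos_le_add fun ε hε hfin => ?_
  obtain ⟨δ, hδ, hsum⟩ := ENNReal.exists_pos_sum_of_countable (ENNReal.coe_ne_zero.2 hε.ne') ℕ
  have hex : ∀ n, ∃ g : X → ℝ≥0∞, LowerSemicontinuous g ∧ (A n).indicator (fun _ => 1) ≤ g ∧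
      capLsc G g < outerCap G (A n) + δ n := fun n =>
    exists_capLsc_lt (ENNReal.lt_add_right
      ((ENNReal.le_tsum n).trans_lt hfin).ne (ENNReal.coe_ne_zero.2 (hδ n).ne'))
  choose g hg hAg hcap using hex
  calc outerCap G (⋃ n, A n) ≤ capLsc G (fun x => ∑' n, g n x) := by
        refine upperCap_le_capLsc (lowerSemicontinuous_tsum hg)
          (indicator_le fun x hx => ?_)
        obtain ⟨n, hn⟩ := mem_iUnion.1 hx
        have := hAg n x
        rw [indicator_of_mem hn] at this
        exact this.trans (ENNReal.le_tsum n)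
    _ ≤ ∑' n, capLsc G (g n) := capLsc_tsum_le hg
    _ ≤ ∑' n, (outerCap G (A n) + δ n) := ENNReal.tsum_le_tsum fun n => (hcap n).le
    _ = ∑' n, outerCap G (A n) + ∑' n, (δ n : ℝ≥0∞) := ENNReal.tsum_add
    _ ≤ ∑' n, outerCap G (A n) + ε := by gcongr

theorem outerCap_union_le (A B : Set X) : outerCap G (A ∪ B) ≤ outerCap G A + outerCap G B := by
  have hempty : outerCap G (∅ : Set X) = 0 := by
    have : outerCap G (∅ : Set X) ≤ capLsc G (fun _ => (0 : ℝ≥0∞)) :=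
      upperCap_le_capLsc lowerSemicontinuous_const (by simp)
    exact le_antisymm (this.trans (capLsc_le lowerSemicontinuous_const (by simp))) zero_le
  let C : ℕ → Set X := fun n => if n = 0 then A else if n = 1 then B else ∅
  have h1 : A ∪ B ⊆ ⋃ n, C n := union_subset (subset_iUnion C 0) (subset_iUnion C 1)
  refine (outerCap_mono h1).trans ((outerCap_iUnion_le C).trans ?_)
  rw [tsum_eq_sum (s := {0, 1}) (by
    intro n hn
    simp only [Finset.mem_insert, Finset.mem_singleton, not_or] at hn
    simp [C, hn, hempty])]
  simp [C]

/-- The capacitary Markov inequality. -/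
theorem outerCap_le_inv_mul (f : X → ℝ≥0∞) (a : ℝ≥0) (ha : a ≠ 0) :
    outerCap G {x | (a : ℝ≥0∞) < f x} ≤ (a : ℝ≥0∞)⁻¹ * upperCap G f := by
  have ha0 : (a : ℝ≥0∞) ≠ 0 := ENNReal.coe_ne_zero.2 ha
  rw [← ENNReal.div_eq_inv_mul, ENNReal.le_div_iff_mul_le (Or.inl ha0)
    (Or.inl ENNReal.coe_ne_top), mul_comm]
  refine le_iInf₂ fun g hg => ?_
  have hlsc : LowerSemicontinuous fun x => (a⁻¹ : ℝ≥0∞) * g x :=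
    (ENNReal.continuous_const_mul (ENNReal.inv_ne_top.2 ha0)).comp_lowerSemicontinuous hg.1
      fun x y h => mul_le_mul' le_rfl h
  have h1 : outerCap G {x | (a : ℝ≥0∞) < f x} ≤ capLsc G fun x => (a⁻¹ : ℝ≥0∞) * g x := by
    refine upperCap_le_capLsc hlsc (indicator_le fun x hx => ?_)
    calc (1 : ℝ≥0∞) = (a : ℝ≥0∞)⁻¹ * a := (ENNReal.inv_mul_cancel ha0 ENNReal.coe_ne_top).symm
      _ ≤ (a : ℝ≥0∞)⁻¹ * g x := by gcongr; exact (le_of_lt hx).trans (hg.2 x)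
  have h2 : capLsc G (fun x => (a⁻¹ : ℝ≥0∞) * g x) ≤ (a : ℝ≥0∞)⁻¹ * capLsc G g :=
    capLsc_le hlsc fun μ hμ => by
      rw [lintegral_const_mul' _ _ (ENNReal.inv_ne_top.2 ha0)]
      gcongr
      exact lintegral_le_capLsc hg.1 hμ
  calc (a : ℝ≥0∞) * outerCap G {x | (a : ℝ≥0∞) < f x}
      ≤ a * ((a : ℝ≥0∞)⁻¹ * capLsc G g) := by gcongr; exact h1.trans h2
    _ = capLsc G g := ENNReal.mul_inv_cancel_left ha0 ENNReal.coe_ne_top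

end Capacity

/-! ### Vague compactness of the energy unit ball. -/

section VagueCompactness

variable {X : Type*} [TopologicalSpace X] [T2Space X] [LocallyCompactSpace X]
  [SecondCountableTopology X] [MeasurableSpace X] [BorelSpace X] {G : X → X → ℝ≥0∞}

/-- Lower semicontinuity and positivity on the diagonal give `G > δ` on `U × U` for a neighbourhood
`U` of each point, so `δ ν(U)² ≤ 1`. Compactness globalizes the bound. -/
theorem IsKernel.exists_measure_le_of_isCompact (hG : IsKernel G) {K : Set X} (hK : IsCompact K) :
    ∃ C : ℝ≥0, ∀ ν ∈ energyUnitBall G, ν K ≤ C := by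
  refine hK.induction_on (p := fun K => ∃ C : ℝ≥0, ∀ ν ∈ energyUnitBall G, ν K ≤ C)
    ⟨0, by simp⟩ (fun s t hst ⟨C, hC⟩ => ⟨C, fun ν hν => (measure_mono hst).trans (hC ν hν)⟩)
    (fun s t ⟨C, hC⟩ ⟨D, hD⟩ => ⟨C + D, fun ν hν => (measure_union_le s t).trans ?_⟩)
    (fun x _ => ?_)
  · rw [ENNReal.coe_add]
    exact add_le_add (hC ν hν) (hD ν hν)
  · obtain ⟨δ, hδ0, hδ⟩ := ENNReal.lt_iff_exists_nnreal_btwn.1 (hG.diag_pos x)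
    have hδ' : δ ≠ 0 := (ENNReal.coe_pos.1 hδ0).ne'
    have hmem : {p : X × X | (δ : ℝ≥0∞) < G p.1 p.2} ∈ 𝓝 (x, x) :=
      (hG.lsc.isOpen_preimage δ).mem_nhds hδ
    obtain ⟨V, W, hV, hxV, hW, hxW, hVW⟩ := mem_nhds_prod_iff'.1 hmem
    obtain ⟨U, hU, hxU, hUU⟩ : ∃ U : Set X, IsOpen U ∧ x ∈ U ∧
        ∀ y ∈ U, ∀ z ∈ U, (δ : ℝ≥0∞) < G y z :=
      ⟨V ∩ W, hV.inter hW, ⟨hxV, hxW⟩, fun y hy z hz =>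
        hVW (show (y, z) ∈ V ×ˢ W from ⟨hy.1, hz.2⟩)⟩
    -- The bound avoids a square root: either `ν U ≤ 1`, or `ν U ≤ (ν U)² ≤ δ⁻¹`.
    refine ⟨U, mem_nhdsWithin_of_mem_nhds (hU.mem_nhds hxU), 1 + δ⁻¹, fun ν hν => ?_⟩
    have h1 : (δ : ℝ≥0∞) * ν U * ν U ≤ 1 := by
      calc (δ : ℝ≥0∞) * ν U * ν U = ∫⁻ _ in U, (δ : ℝ≥0∞) * ν U ∂ν := by
            rw [setLIntegral_const]
        _ ≤ ∫⁻ x in U, potential G ν x ∂ν := by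
            refine setLIntegral_mono' hU.measurableSet fun y hy => ?_
            calc (δ : ℝ≥0∞) * ν U = ∫⁻ _ in U, (δ : ℝ≥0∞) ∂ν := by rw [setLIntegral_const]
              _ ≤ ∫⁻ z in U, G y z ∂ν :=
                setLIntegral_mono' hU.measurableSet fun z hz => (hUU y hy z hz).le
              _ ≤ potential G ν y := setLIntegral_le_lintegral _ _
        _ ≤ energy G ν := setLIntegral_le_lintegral _ _
        _ ≤ 1 := hν.2
    push_cast
    rcases le_total (ν U) 1 with h | h
    · exact h.trans le_self_add
    · refine le_trans ?_ le_add_self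
      rw [ENNReal.coe_inv hδ', ENNReal.le_inv_iff_mul_le, mul_comm]
      exact (le_mul_of_one_le_right' h).trans h1

theorem IsKernel.exists_lintegral_le (hG : IsKernel G) {h : X → ℝ≥0∞} (hh : h ∈ uscCompact X) :
    ∃ C : ℝ≥0, ∀ ν ∈ energyUnitBall G, ∫⁻ x, h x ∂ν ≤ C := by
  obtain ⟨M, hM⟩ := exists_forall_le_of_mem_uscCompact hh
  obtain ⟨C, hC⟩ := hG.exists_measure_le_of_isCompact hh.2.2.isCompact
  refine ⟨M * C, fun ν hν => ?_⟩
  calc ∫⁻ x, h x ∂ν = ∫⁻ x in tsupport h, h x ∂ν :=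
        (setLIntegral_eq_of_support_subset (subset_tsupport h)).symm
    _ ≤ ∫⁻ _ in tsupport h, M ∂ν := lintegral_mono hM
    _ = M * ν (tsupport h) := by rw [setLIntegral_const]
    _ ≤ (M * C : ℝ≥0) := by rw [ENNReal.coe_mul]; gcongr; exact hC ν hν

/-- Vague convergence of measures along a filter, tested on `contCompact X`. -/
def VagueTendsto {ι : Type*} (ν : ι → Measure X) (l : Filter ι) (σ : Measure X) : Prop :=
  ∀ φ ∈ contCompact X, Tendsto (fun i => ∫⁻ x, φ x ∂(ν i)) l (𝓝 (∫⁻ x, φ x ∂σ))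

theorem VagueTendsto.lintegral_le {ι : Type*} {ν : ι → Measure X} {l : Filter ι} [l.NeBot]
    {σ : Measure X} (h : VagueTendsto ν l σ) {g : X → ℝ≥0∞} (hg : LowerSemicontinuous g)
    {a : ℝ≥0∞} (ha : ∀ᶠ i in l, ∫⁻ x, g x ∂(ν i) ≤ a) : ∫⁻ x, g x ∂σ ≤ a := by
  obtain ⟨φ, hφ, hmono, hsup⟩ := exists_monotone_contCompact_iSup_eq hg
  simp_rw [← hsup]
  rw [lintegral_iSup (fun n => (hφ n).1.measurable) hmono]
  refine iSup_le fun n => le_of_tendsto (h _ (hφ n)) ?_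
  filter_upwards [ha] with i hi
  exact (lintegral_mono fun x => (le_iSup (fun n => φ n x) n).trans_eq (hsup x)).trans hi

theorem VagueTendsto.le_lintegral {ι : Type*} {ν : ι → Measure X} {l : Filter ι} [l.NeBot]
    {σ : Measure X} [σ.Regular] (h : VagueTendsto ν l σ) {u : X → ℝ≥0∞} (hu : u ∈ uscCompact X)
    {a : ℝ≥0∞} (ha : ∀ᶠ i in l, a ≤ ∫⁻ x, u x ∂(ν i)) : a ≤ ∫⁻ x, u x ∂σ := by
  obtain ⟨φ, hφ, hanti, hinf⟩ := exists_antitone_contCompact_iInf_eq hu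
  have hfin : ∫⁻ x, φ 0 x ∂σ ≠ ∞ := by
    obtain ⟨M, hM⟩ := exists_forall_le_of_mem_uscCompact (contCompact_subset_uscCompact (hφ 0))
    refine ne_top_of_le_ne_top (b := M * σ (tsupport (φ 0)))
      (ENNReal.mul_ne_top ENNReal.coe_ne_top (hφ 0).2.2.isCompact.measure_lt_top.ne) ?_
    rw [← setLIntegral_eq_of_support_subset (subset_tsupport (φ 0)), ← setLIntegral_const]
    exact lintegral_mono hM
  simp_rw [← hinf]
  rw [lintegral_iInf (fun n => (hφ n).1.measurable) hanti hfin]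
  refine le_iInf fun n => ge_of_tendsto (h _ (hφ n)) ?_
  filter_upwards [ha] with i hi
  exact hi.trans (lintegral_mono fun x => (hinf x).symm.trans_le (iInf_le (fun n => φ n x) n))

/-- The energy unit ball is vaguely compact. -/
theorem exists_vagueTendsto (hG : IsKernel G) (hpos : IsPosDef G) {ι : Type*} (𝒰 : Ultrafilter ι)
    {ν : ι → Measure X} (hν : ∀ i, ν i ∈ energyUnitBall G) :
    ∃ σ ∈ energyUnitBall G, VagueTendsto ν 𝒰 σ := by
  have hmem : ∀ f : C_c(X, ℝ≥0), (fun x => (f x : ℝ≥0∞)) ∈ contCompact X := fun f =>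
    ⟨ENNReal.continuous_coe.comp f.continuous, fun _ => ENNReal.coe_ne_top,
      f.hasCompactSupport.comp_left ENNReal.coe_zero⟩
  have hlim : ∀ f : C_c(X, ℝ≥0), ∃ L : ℝ≥0,
      Tendsto (fun i => ∫⁻ x, f x ∂(ν i)) 𝒰 (𝓝 (L : ℝ≥0∞)) := by
    intro f
    obtain ⟨C, hC⟩ := hG.exists_lintegral_le (contCompact_subset_uscCompact (hmem f))
    have ht : Tendsto (fun i => ∫⁻ x, f x ∂(ν i)) 𝒰
        (𝓝 (𝒰.map fun i => ∫⁻ x, f x ∂(ν i)).lim) :=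
      (𝒰.map fun i => ∫⁻ x, f x ∂(ν i)).le_nhds_lim
    have hle := le_of_tendsto ht (Eventually.of_forall fun i => hC _ (hν i))
    refine ⟨(𝒰.map fun i => ∫⁻ x, f x ∂(ν i)).lim.toNNReal, ?_⟩
    rwa [ENNReal.coe_toNNReal (ne_top_of_le_ne_top ENNReal.coe_ne_top hle)]
  choose L hL using hlim
  let Λ : C_c(X, ℝ≥0) →ₗ[ℝ≥0] ℝ≥0 :=
    { toFun := L
      map_add' := fun f g => by
        have h := (hL f).add (hL g)
        have hfg := hL (f + g)
        have heq : (fun i => ∫⁻ x, (f + g) x ∂(ν i)) =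
            fun i => ∫⁻ x, f x ∂(ν i) + ∫⁻ x, g x ∂(ν i) := by
          funext i
          rw [← lintegral_add_left (hmem f).1.measurable]
          simp
        rw [heq] at hfg
        exact_mod_cast tendsto_nhds_unique hfg h
      map_smul' := fun c f => by
        have h := ENNReal.Tendsto.const_mul (a := (c : ℝ≥0∞)) (hL f) (Or.inr ENNReal.coe_ne_top)
        have hcf := hL (c • f)
        have heq : (fun i => ∫⁻ x, (c • f) x ∂(ν i)) = fun i => c * ∫⁻ x, f x ∂(ν i) := by
          funext i
          rw [← lintegral_const_mul' _ _ ENNReal.coe_ne_top]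
          simp
        rw [heq] at hcf
        exact_mod_cast tendsto_nhds_unique hcf h }
  have hvague : VagueTendsto ν 𝒰 (NNRealRMK.rieszMeasure Λ) := by
    intro φ hφ
    let f : C_c(X, ℝ≥0) :=
      ⟨⟨fun x => (φ x).toNNReal, continuous_iff_continuousAt.2 fun x =>
        (ENNReal.tendsto_toNNReal (hφ.2.1 x)).comp hφ.1.continuousAt⟩,
        hφ.2.2.comp_left ENNReal.toNNReal_zero⟩
    have hf : ∀ x, φ x = f x := fun x => (ENNReal.coe_toNNReal (hφ.2.1 x)).symm
    simp_rw [hf, NNRealRMK.lintegral_rieszMeasure]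
    exact hL f
  refine ⟨NNRealRMK.rieszMeasure Λ, ⟨inferInstance, ?_⟩, hvague⟩
  have hreg : ∀ i, (ν i).Regular := fun i => (hν i).1
  -- The limit is taken in one variable at a time: with `j` fixed, mutual energies with `ν i` are at
  -- most `1` by positive definiteness, and lower semicontinuity of integrals passes this to the
  -- limit in `i`, then in `j`.
  refine hvague.lintegral_le (hG.lowerSemicontinuous_potential _) (Eventually.of_forall fun j => ?_)
  rw [hG.lintegral_potential_comm]
  exact hvague.lintegral_le (hG.lowerSemicontinuous_potential _)
    (Eventually.of_forall fun i => hpos.lintegral_potential_le_one (hν j) (hν i))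

end VagueCompactness

/-! ### The capacitary closure of the u.s.c. functions, and attainment of capacity. -/

section Closure

variable {X : Type*} [TopologicalSpace X] [T2Space X] [LocallyCompactSpace X]
  [SecondCountableTopology X] [MeasurableSpace X] [BorelSpace X] {G : X → X → ℝ≥0∞}

/-- The error is carried by an l.s.c. function `g` whose integral is below `ε` uniformly over the
energy unit ball; the additive form avoids truncated subtraction. -/
theorem mem_uscCompactClosure_iff {f : X → ℝ≥0∞} :
    f ∈ uscCompactClosure G ↔ ∀ ε : ℝ≥0∞, 0 < ε → ∃ h ∈ uscCompact X, ∃ g : X → ℝ≥0∞,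
      LowerSemicontinuous g ∧ capLsc G g < ε ∧ (∀ x, f x ≤ h x + g x) ∧
        ∀ x, h x ≤ f x + g x := by
  refine forall₂_congr fun ε _ => exists_congr fun h => and_congr_right fun _ => ⟨fun H => ?_, ?_⟩
  · obtain ⟨g, hg, hle, hcap⟩ := exists_capLsc_lt H
    exact ⟨g, hg, hcap, fun x => tsub_le_iff_left.1 ((le_max_left _ _).trans (hle x)),
      fun x => tsub_le_iff_left.1 ((le_max_right _ _).trans (hle x))⟩
  · rintro ⟨g, hg, hcap, h1, h2⟩
    exact (upperCap_le_capLsc hg fun x => max_le (tsub_le_iff_left.2 (h1 x))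
      (tsub_le_iff_left.2 (h2 x))).trans_lt hcap

theorem inf_mem_uscCompactClosure {f k : X → ℝ≥0∞} (hf : f ∈ uscCompactClosure G)
    (hk : k ∈ uscCompactClosure G) : (fun x => min (f x) (k x)) ∈ uscCompactClosure G := by
  rw [mem_uscCompactClosure_iff] at hf hk ⊢
  intro ε hε
  have hε2 : 0 < ε / 2 := ENNReal.half_pos hε.ne'
  obtain ⟨h₁, hh₁, g₁, hg₁, hc₁, ha₁, hb₁⟩ := hf _ hε2
  obtain ⟨h₂, hh₂, g₂, hg₂, hc₂, ha₂, hb₂⟩ := hk _ hε2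
  refine ⟨_, inf_mem_uscCompact hh₁ hh₂, _, hg₁.add hg₂,
    (capLsc_add_le hg₁ hg₂).trans_lt ((ENNReal.add_lt_add hc₁ hc₂).trans_eq (ENNReal.add_halves ε)),
    fun x => ?_, fun x => ?_⟩
  · rw [← min_add_add_right]
    exact min_le_min ((ha₁ x).trans (by gcongr; exact le_self_add))
      ((ha₂ x).trans (by gcongr; exact le_add_self))
  · rw [← min_add_add_right]
    exact min_le_min ((hb₁ x).trans (by gcongr; exact le_self_add))
      ((hb₂ x).trans (by gcongr; exact le_add_self))

theorem tsub_mem_uscCompactClosure {f w : X → ℝ≥0∞} (hf : f ∈ uscCompactClosure G)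
    (hw : LowerSemicontinuous w) : (fun x => f x - w x) ∈ uscCompactClosure G := by
  rw [mem_uscCompactClosure_iff] at hf ⊢
  intro ε hε
  obtain ⟨h, hh, g, hg, hc, ha, hb⟩ := hf _ hε
  have key : ∀ a b c d : ℝ≥0∞, a ≤ b + c → a - d ≤ b - d + c := fun a b c d habc =>
    tsub_le_iff_right.2 (habc.trans (by
      rw [add_right_comm]; gcongr; exact le_tsub_add))
  exact ⟨_, tsub_mem_uscCompact hh hw, g, hg, hc, fun x => key _ _ _ _ (ha x),
    fun x => key _ _ _ _ (hb x)⟩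

theorem VagueTendsto.le_lintegral_of_mem_closure {ι : Type*} {ν : ι → Measure X} {l : Filter ι}
    [l.NeBot] {σ : Measure X} (h : VagueTendsto ν l σ) (hν : ∀ i, ν i ∈ energyUnitBall G)
    (hσ : σ ∈ energyUnitBall G) {f : X → ℝ≥0∞} (hf : f ∈ uscCompactClosure G)
    {a : ℝ≥0∞} (ha : ∀ᶠ i in l, a ≤ ∫⁻ x, f x ∂(ν i)) : a ≤ ∫⁻ x, f x ∂σ := by
  have := hσ.1
  refine ENNReal.le_of_forall_pos_le_add fun ε hε _ => ?_
  obtain ⟨u, hu, g, hg, hc, hfu, huf⟩ := mem_uscCompactClosure_iff.1 hf (ε / 2)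
    (ENNReal.half_pos (ENNReal.coe_ne_zero.2 hε.ne'))
  have h1 : a - ε / 2 ≤ ∫⁻ x, u x ∂σ := by
    refine h.le_lintegral hu ?_
    filter_upwards [ha] with i hi
    rw [tsub_le_iff_right]
    calc a ≤ ∫⁻ x, u x + g x ∂(ν i) := hi.trans (lintegral_mono hfu)
      _ = ∫⁻ x, u x ∂(ν i) + ∫⁻ x, g x ∂(ν i) := lintegral_add_right _ hg.measurable
      _ ≤ _ := by gcongr; exact (lintegral_le_capLsc hg (hν i)).trans hc.le
  calc a ≤ ∫⁻ x, u x ∂σ + ε / 2 := tsub_le_iff_right.1 h1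
    _ ≤ ∫⁻ x, f x + g x ∂σ + ε / 2 := by gcongr with x; exact huf x
    _ = ∫⁻ x, f x ∂σ + ∫⁻ x, g x ∂σ + ε / 2 := by rw [lintegral_add_right _ hg.measurable]
    _ ≤ ∫⁻ x, f x ∂σ + ε / 2 + ε / 2 := by
      gcongr; exact (lintegral_le_capLsc hg hσ).trans hc.le
    _ = _ := by rw [add_assoc, ENNReal.add_halves]

theorem contCompact_subset_uscCompactClosure : contCompact X ⊆ uscCompactClosure G := by
  intro φ hφ
  refine mem_uscCompactClosure_iff.2 fun ε hε => ⟨φ, contCompact_subset_uscCompact hφ,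
    fun _ => 0, lowerSemicontinuous_const, ?_, by simp, by simp⟩
  exact (capLsc_le (a := 0) lowerSemicontinuous_const (by simp)).trans_lt hε

theorem upperCap_add_le {f g : X → ℝ≥0∞} (hg : LowerSemicontinuous g) :
    upperCap G (fun x => f x + g x) ≤ upperCap G f + capLsc G g := by
  rw [← tsub_le_iff_right]
  refine le_iInf₂ fun k hk => ?_
  rw [tsub_le_iff_right]
  exact (upperCap_le_capLsc (hk.1.add hg) fun x => add_le_add (hk.2 x) le_rfl).trans
    (capLsc_add_le hk.1 hg)

/-- A vague limit of almost maximizing measures works: for fixed `n` the later measures almost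
maximize a smaller function, so their integrals of `f n` are large too, and this survives in the
limit. -/
theorem exists_le_lintegral_iInf (hG : IsKernel G) (hpos : IsPosDef G) {f : ℕ → X → ℝ≥0∞}
    (hf : ∀ n, f n ∈ uscCompactClosure G) (hmeas : ∀ n, Measurable (f n)) (hanti : Antitone f)
    (hfin : ∀ σ ∈ energyUnitBall G, ∫⁻ x, f 0 x ∂σ ≠ ∞) {c : ℝ≥0∞}
    (hc : ∀ n, c ≤ ⨆ σ ∈ energyUnitBall G, ∫⁻ x, f n x ∂σ) :
    ∃ σ ∈ energyUnitBall G, c ≤ ∫⁻ x, ⨅ n, f n x ∂σ := by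
  rcases eq_or_ne c 0 with rfl | hc0
  · exact ⟨0, zero_mem_energyUnitBall, zero_le⟩
  -- Levels increasing to `c` also cover `c = ∞`.
  obtain ⟨a, hamono, halt, hatend⟩ := exists_seq_strictMono_tendsto' (pos_iff_ne_zero.2 hc0)
  have hex : ∀ n, ∃ σ ∈ energyUnitBall G, a n < ∫⁻ x, f n x ∂σ := fun n => by
    simpa only [lt_iSup_iff, exists_prop] using (halt n).2.trans_le (hc n)
  choose ν hν haν using hex
  obtain ⟨σ, hσ, hvague⟩ := exists_vagueTendsto hG hpos (hyperfilter ℕ) hν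
  refine ⟨σ, hσ, ?_⟩
  rw [lintegral_iInf hmeas hanti (hfin σ hσ)]
  refine le_iInf fun n => le_of_tendsto' hatend fun k => ?_
  refine hvague.le_lintegral_of_mem_closure hν hσ (hf n) ?_
  have hev : ∀ᶠ i in atTop, a k ≤ ∫⁻ x, f n x ∂(ν i) := by
    filter_upwards [eventually_ge_atTop k, eventually_ge_atTop n] with i hki hni
    exact (hamono.monotone hki).trans ((haν i).le.trans (lintegral_mono (hanti hni)))
  exact (Nat.hyperfilter_le_atTop) hev

theorem exists_upperCap_le_of_mem_uscCompact (hG : IsKernel G) (hpos : IsPosDef G) {h : X → ℝ≥0∞}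
    (hh : h ∈ uscCompact X) : ∃ σ ∈ energyUnitBall G, upperCap G h ≤ ∫⁻ x, h x ∂σ := by
  obtain ⟨φ, hφ, hanti, hinf⟩ := exists_antitone_contCompact_iInf_eq hh
  simp_rw [← hinf]
  refine exists_le_lintegral_iInf hG hpos (fun n => contCompact_subset_uscCompactClosure (hφ n))
    (fun n => (hφ n).1.measurable) hanti (fun σ hσ => ?_) fun n => ?_
  · obtain ⟨C, hC⟩ := hG.exists_lintegral_le (contCompact_subset_uscCompact (hφ 0))
    exact ne_top_of_le_ne_top ENNReal.coe_ne_top (hC σ hσ)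
  · rw [← capLsc_eq (hφ n).1.lowerSemicontinuous]
    exact upperCap_le_capLsc (hφ n).1.lowerSemicontinuous fun x =>
      (hinf x).symm.trans_le (iInf_le (fun n => φ n x) n)

/-- This is the nontrivial half of the duality formula for `upperCap`, passed from `uscCompact X` to
its closure; the easy half is `lintegral_le_upperCap`. -/
theorem upperCap_le_iSup_of_mem_closure (hG : IsKernel G) (hpos : IsPosDef G) {f : X → ℝ≥0∞}
    (hf : f ∈ uscCompactClosure G) : upperCap G f ≤ ⨆ σ ∈ energyUnitBall G, ∫⁻ x, f x ∂σ := by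
  refine ENNReal.le_of_forall_pos_le_add fun ε hε _ => ?_
  obtain ⟨u, hu, g, hg, hc, hfu, huf⟩ := mem_uscCompactClosure_iff.1 hf (ε / 2)
    (ENNReal.half_pos (ENNReal.coe_ne_zero.2 hε.ne'))
  obtain ⟨σ, hσ, hle⟩ := exists_upperCap_le_of_mem_uscCompact hG hpos hu
  calc upperCap G f ≤ upperCap G u + capLsc G g := (upperCap_mono hfu).trans (upperCap_add_le hg)
    _ ≤ ∫⁻ x, f x + g x ∂σ + ε / 2 :=
        add_le_add (hle.trans (lintegral_mono huf)) hc.le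
    _ = ∫⁻ x, f x ∂σ + ∫⁻ x, g x ∂σ + ε / 2 := by rw [lintegral_add_right _ hg.measurable]
    _ ≤ (⨆ σ ∈ energyUnitBall G, ∫⁻ x, f x ∂σ) + ε / 2 + ε / 2 := by
      gcongr
      · exact le_iSup₂ (f := fun (σ : Measure X) (_ : σ ∈ energyUnitBall G) => ∫⁻ x, f x ∂σ) σ hσ
      · exact (lintegral_le_capLsc hg hσ).trans hc.le
    _ = _ := by rw [add_assoc, ENNReal.add_halves]

/-- The capacity of the infimum of a decreasing sequence in `uscCompactClosure G` is attained by a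
measure of the energy unit ball. -/
theorem exists_upperCap_iInf_le (hG : IsKernel G) (hpos : IsPosDef G) {f : ℕ → X → ℝ≥0∞}
    (hf : ∀ n, f n ∈ uscCompactClosure G) (hmeas : ∀ n, Measurable (f n)) (hanti : Antitone f)
    (hfin : ∀ σ ∈ energyUnitBall G, ∫⁻ x, f 0 x ∂σ ≠ ∞) :
    ∃ σ ∈ energyUnitBall G, upperCap G (fun x => ⨅ n, f n x) ≤ ∫⁻ x, ⨅ n, f n x ∂σ :=
  exists_le_lintegral_iInf hG hpos hf hmeas hanti hfin fun n =>
    (upperCap_mono fun x => iInf_le (fun n => f n x) n).trans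
      (upperCap_le_iSup_of_mem_closure hG hpos (hf n))

/-- As in Egorov's theorem, the Markov inequality makes suitable u.s.c. approximants converge
uniformly off a set of small capacity. -/
theorem quasiUSC_of_mem_closure {f : X → ℝ≥0∞} (hf : f ∈ uscCompactClosure G) :
    QuasiUSC G f := by
  intro ε hε
  obtain ⟨ε', hε', hsum⟩ := ENNReal.exists_pos_sum_of_countable' hε.ne' ℕ
  let δ : ℕ → ℝ≥0 := fun n => 1 / ((n : ℝ≥0) + 1)
  have hδ : ∀ n, δ n ≠ 0 := fun n => by positivity
  have hδ' : ∀ n, (δ n : ℝ≥0∞) ≠ 0 := fun n => ENNReal.coe_ne_zero.2 (hδ n)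
  have hδt : Tendsto (fun n => δ n + δ n) atTop (𝓝 0) := by
    simpa [δ] using (tendsto_one_div_add_atTop_nhds_zero_nat (𝕜 := ℝ≥0)).add
      (tendsto_one_div_add_atTop_nhds_zero_nat (𝕜 := ℝ≥0))
  -- The factor `δ n` cancels against the Markov constant, leaving the summable `ε' n`.
  choose h hh hcap using fun n => hf (δ n * ε' n) (ENNReal.mul_pos (hδ' n) (hε' n).ne')
  let d : ℕ → X → ℝ≥0∞ := fun n x => max (f x - h n x) (h n x - f x)
  refine ⟨⋃ n, {x | (δ n : ℝ≥0∞) < d n x}, ?_, fun x hx a hxa => ?_⟩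
  · refine ((outerCap_iUnion_le _).trans (ENNReal.tsum_le_tsum fun n => ?_)).trans_lt hsum
    calc _ ≤ (δ n : ℝ≥0∞)⁻¹ * upperCap G (d n) := outerCap_le_inv_mul _ _ (hδ n)
      _ ≤ (δ n : ℝ≥0∞)⁻¹ * (δ n * ε' n) := by gcongr; exact (hcap n).le
      _ = ε' n := by
        rw [← mul_assoc, ENNReal.inv_mul_cancel (hδ' n) ENNReal.coe_ne_top, one_mul]
  · have hd : ∀ y ∈ (⋃ n, {x | (δ n : ℝ≥0∞) < d n x})ᶜ, ∀ n,
        f y ≤ h n y + δ n ∧ h n y ≤ f y + δ n := by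
      intro y hy n
      have hyn : d n y ≤ δ n := not_lt.1 fun hlt => hy (mem_iUnion.2 ⟨n, hlt⟩)
      exact ⟨tsub_le_iff_left.1 ((le_max_left _ _).trans hyn),
        tsub_le_iff_left.1 ((le_max_right _ _).trans hyn)⟩
    obtain ⟨r, hr, hra⟩ := ENNReal.lt_iff_exists_add_pos_lt.1 hxa
    obtain ⟨n, hn⟩ := (hδt.eventually (gt_mem_nhds hr)).exists
    have hlt : h n x + δ n < a := by
      refine lt_of_le_of_lt ?_ hra
      calc h n x + δ n ≤ f x + δ n + δ n := by gcongr; exact (hd x hx n).2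
        _ = f x + ((δ n + δ n : ℝ≥0) : ℝ≥0∞) := by rw [ENNReal.coe_add, add_assoc]
        _ ≤ f x + r := by gcongr
    have husc : UpperSemicontinuous fun y => h n y + (δ n : ℝ≥0∞) :=
      (hh n).1.add upperSemicontinuous_const
    filter_upwards [mem_nhdsWithin_of_mem_nhds (husc x a hlt), self_mem_nhdsWithin] with y hy hyV
    exact ((hd y hyV n).1).trans_lt hy

end Closure

/-! ### The extremal measure and the envelope of a sequence. -/

section Envelope

variable {X : Type*} [TopologicalSpace X] [T2Space X] [LocallyCompactSpace X]
  [SecondCountableTopology X] [MeasurableSpace X] [BorelSpace X] {G : X → X → ℝ≥0∞}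

/-- Euler inequality for a maximiser of a linear functional on the energy unit ball. -/
theorem lintegral_le_mul_lintegral_potential (hG : IsKernel G) (hpos : IsPosDef G)
    {f : X → ℝ≥0∞} {μ : Measure X} (hμ : μ ∈ energyUnitBall G) {c : ℝ≥0}
    (hc : ∫⁻ x, f x ∂μ = c) (hmax : ∀ σ ∈ energyUnitBall G, ∫⁻ x, f x ∂σ ≤ c)
    {σ : Measure X} (hσ : σ ∈ energyUnitBall G) :
    ∫⁻ x, f x ∂σ ≤ c * ∫⁻ x, potential G μ x ∂σ := by
  have := hμ.1
  have := hσ.1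
  -- Homogeneity extends the maximality of `μ` to measures outside the unit ball.
  have hscale : ∀ (τ : Measure X) (s : ℝ≥0), τ.Regular → s ≠ 0 → energy G τ ≤ (s : ℝ≥0∞) ^ 2 →
      ∫⁻ x, f x ∂τ ≤ s * c := by
    intro τ s hτ hs hle
    have hs0 : (s : ℝ≥0∞) ≠ 0 := ENNReal.coe_ne_zero.2 hs
    have hmem : s⁻¹ • τ ∈ energyUnitBall G := by
      refine ⟨inferInstance, ?_⟩
      rw [energy_smul, ENNReal.coe_inv hs]
      calc ((s : ℝ≥0∞)⁻¹) ^ 2 * energy G τ ≤ ((s : ℝ≥0∞)⁻¹) ^ 2 * (s : ℝ≥0∞) ^ 2 := by gcongr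
        _ = 1 := by rw [← mul_pow, ENNReal.inv_mul_cancel hs0 ENNReal.coe_ne_top, one_pow]
    have h := hmax _ hmem
    rw [lintegral_smul_measure, ENNReal.smul_def, smul_eq_mul, ENNReal.coe_inv hs] at h
    calc ∫⁻ x, f x ∂τ = s * ((s : ℝ≥0∞)⁻¹ * ∫⁻ x, f x ∂τ) :=
          (ENNReal.mul_inv_cancel_left hs0 ENNReal.coe_ne_top).symm
      _ ≤ s * c := by gcongr
  obtain ⟨a, ha⟩ : ∃ a : ℝ≥0, ∫⁻ x, potential G μ x ∂σ = a :=
    ⟨_, (ENNReal.coe_toNNReal (ne_top_of_le_ne_top ENNReal.one_ne_top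
      (hpos.lintegral_potential_le_one hμ hσ))).symm⟩
  obtain ⟨F, hF⟩ : ∃ F : ℝ≥0, ∫⁻ x, f x ∂σ = F :=
    ⟨_, (ENNReal.coe_toNNReal (ne_top_of_le_ne_top ENNReal.coe_ne_top (hmax σ hσ))).symm⟩
  rw [ha, hF]
  have key : ∀ t : ℝ≥0, t ≠ 0 → F ≤ c * (a + t) := by
    intro t ht
    -- The energy is at most `1 + 2ta + t²`. The square of `1 + t(a + t)` dominates this without a
    -- square root and agrees with it to first order in `t`.
    have hE : energy G (μ + t • σ) ≤ ((1 + t * (a + t) : ℝ≥0) : ℝ≥0∞) ^ 2 := by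
      rw [hG.energy_add_smul, ha]
      calc energy G μ + 2 * t * a + (t : ℝ≥0∞) ^ 2 * energy G σ
          ≤ 1 + 2 * t * a + (t : ℝ≥0∞) ^ 2 * 1 := by
            gcongr
            · exact hμ.2
            · exact hσ.2
        _ = ((1 + 2 * t * a + t ^ 2 * 1 : ℝ≥0) : ℝ≥0∞) := by push_cast; rfl
        _ ≤ ((1 + t * (a + t)) ^ 2 : ℝ≥0) := by
            refine ENNReal.coe_le_coe.2 ?_
            calc 1 + 2 * t * a + t ^ 2 * 1
                ≤ 1 + 2 * t * a + t ^ 2 * 1 + (t ^ 2 + (t * (a + t)) ^ 2) := le_self_add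
              _ = (1 + t * (a + t)) ^ 2 := by ring
        _ = _ := by push_cast; rfl
    have hreg : (μ + t • σ).Regular := by
      have : IsFiniteMeasureOnCompacts (μ + t • σ) :=
        ⟨fun K hK => by
          rw [Measure.add_apply]
          exact ENNReal.add_lt_top.2 ⟨hK.measure_lt_top, hK.measure_lt_top⟩⟩
      infer_instance
    have h := hscale _ _ hreg (by positivity) hE
    rw [lintegral_add_measure, lintegral_smul_measure, hc, hF, ENNReal.smul_def,
      smul_eq_mul] at h
    have h' : c + t * F ≤ (1 + t * (a + t)) * c := by exact_mod_cast h
    rw [add_mul, one_mul, add_le_add_iff_left] at h'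
    refine le_of_mul_le_mul_left ?_ (pos_iff_ne_zero.2 ht)
    calc t * F ≤ t * (a + t) * c := h'
      _ = t * (c * (a + t)) := by ring
  have hlim : Tendsto (fun n : ℕ => c * (a + 1 / ((n : ℝ≥0) + 1))) atTop (𝓝 (c * (a + 0))) :=
    (tendsto_one_div_add_atTop_nhds_zero_nat.const_add a).const_mul c
  rw [add_zero] at hlim
  exact_mod_cast ge_of_tendsto' hlim fun n => key _ (by positivity)

theorem iInf_tsub_eq_zero {f : ℕ → ℝ≥0∞} {w : ℝ≥0∞} (h : ⨅ n, f n ≤ w) :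
    ⨅ n, (f n - w) = 0 := by
  by_contra hne
  have hpos := pos_iff_ne_zero.2 hne
  -- This forces `w` to be finite, so adding it back to the differences is legitimate.
  have hw : ∀ n, w < f n := fun n => tsub_pos_iff_lt.1 (hpos.trans_le (iInf_le _ n))
  have hle : (⨅ n, (f n - w)) + w ≤ ⨅ n, f n := le_iInf fun n =>
    (add_le_add (iInf_le _ n) le_rfl).trans_eq (tsub_add_cancel_of_le (hw n).le)
  refine (hle.trans h).not_gt ?_
  rw [add_comm]
  exact ENNReal.lt_add_right ((hw 0).trans_le le_top).ne hne

/-- The capacity of the excess over `w` is bounded by its integral against a single measure of the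
ball, and that integral vanishes by `hle`. -/
theorem quasiEverywhere_iInf_le (hG : IsKernel G) (hpos : IsPosDef G) {f : ℕ → X → ℝ≥0∞}
    (hf : ∀ n, f n ∈ uscCompactClosure G) (hmeas : ∀ n, Measurable (f n)) (hanti : Antitone f)
    (hfin : ∀ σ ∈ energyUnitBall G, ∫⁻ x, f 0 x ∂σ ≠ ∞) {w : X → ℝ≥0∞}
    (hw : LowerSemicontinuous w)
    (hle : ∀ σ ∈ energyUnitBall G, ∀ᵐ x ∂σ, ⨅ n, f n x ≤ w x) :
    QuasiEverywhere G fun x => ⨅ n, f n x ≤ w x := by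
  obtain ⟨σ, hσ, hcap⟩ := exists_upperCap_iInf_le hG hpos (f := fun n x => f n x - w x)
    (fun n => tsub_mem_uscCompactClosure (hf n) hw) (fun n => (hmeas n).sub hw.measurable)
    (fun m n hmn x => tsub_le_tsub_right (hanti hmn x) _)
    (fun σ hσ => ne_top_of_le_ne_top (hfin σ hσ) (lintegral_mono fun x => tsub_le_self))
  have hzero : upperCap G (fun x => (⨅ n, f n x) - w x) = 0 := by
    refine le_antisymm ?_ zero_le
    calc upperCap G (fun x => (⨅ n, f n x) - w x)
        ≤ upperCap G fun x => ⨅ n, (f n x - w x) :=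
          upperCap_mono fun x => le_iInf fun n => tsub_le_tsub_right (iInf_le _ n) _
      _ ≤ ∫⁻ x, ⨅ n, (f n x - w x) ∂σ := hcap
      _ = ∫⁻ _, 0 ∂σ := lintegral_congr_ae (by
          filter_upwards [hle σ hσ] with x hx using iInf_tsub_eq_zero hx)
      _ = 0 := lintegral_zero
  have hsub : {x | ¬ ⨅ n, f n x ≤ w x} ⊆
      ⋃ k : ℕ, {x | ((1 / ((k : ℝ≥0) + 1) : ℝ≥0) : ℝ≥0∞) < (⨅ n, f n x) - w x} := by
    intro x hx
    have hx' : 0 < (⨅ n, f n x) - w x := tsub_pos_iff_lt.2 (not_le.1 hx)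
    have hlim : Tendsto (fun k : ℕ => ((1 / ((k : ℝ≥0) + 1) : ℝ≥0) : ℝ≥0∞)) atTop (𝓝 0) :=
      ENNReal.tendsto_coe.2 tendsto_one_div_add_atTop_nhds_zero_nat
    exact mem_iUnion.2 (hlim.eventually (gt_mem_nhds hx')).exists
  refine le_antisymm ((outerCap_mono hsub).trans ((outerCap_iUnion_le _).trans ?_)) zero_le
  refine (ENNReal.tsum_le_tsum fun k => outerCap_le_inv_mul _ _ (by positivity)).trans ?_
  simp [hzero]

/-- The lower envelope of a sequence of potentials of finite energy dominates a potential of finite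
energy to which it is equal quasi-everywhere. -/
theorem exists_potential_le_of_seq (hG : IsKernel G) (hcons : IsConsistent G) (hpos : IsPosDef G)
    (hdom : DominationPrinciple G) {ν : ℕ → Measure X} (hν : ∀ n, ν n ∈ finiteEnergy G) :
    ∃ ω ∈ finiteEnergy G, (∀ n x, potential G ω x ≤ potential G (ν n) x) ∧
      QuasiEverywhere G fun x => ⨅ n, potential G (ν n) x ≤ potential G ω x := by
  let f : ℕ → X → ℝ≥0∞ := fun n x => ⨅ k ≤ n, potential G (ν k) x
  have hinf : ∀ x, ⨅ n, f n x = ⨅ n, potential G (ν n) x := fun x =>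
    le_antisymm (le_iInf fun n => (iInf_le _ n).trans
      (iInf₂_le (f := fun k (_ : k ≤ n) => potential G (ν k) x) n le_rfl))
      (le_iInf fun n => le_iInf₂ fun k _ => iInf_le _ k)
  have hf : ∀ n, f n ∈ uscCompactClosure G := by
    intro n
    induction n with
    | zero =>
      have : f 0 = potential G (ν 0) := by funext x; simp [f]
      rw [this]
      exact hcons _ (hν 0)
    | succ n ih =>
      have : f (n + 1) = fun x => min (f n x) (potential G (ν (n + 1)) x) := by
        funext x
        exact Nat.iInf_le_succ (fun k => potential G (ν k) x) n
      rw [this]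
      exact inf_mem_uscCompactClosure ih (hcons _ (hν _))
  have hmeas : ∀ n, Measurable (f n) := fun n =>
    .iInf fun k => .iInf fun _ => hG.measurable_potential _
  have hanti : Antitone f := fun m n hmn x => biInf_mono fun k hk => le_trans hk hmn
  have hfin : ∀ σ ∈ energyUnitBall G, ∫⁻ x, f 0 x ∂σ ≠ ∞ := fun σ hσ =>
    ne_top_of_le_ne_top
      (hpos.lintegral_potential_lt_top (hν 0) (mem_finiteEnergy_of_mem_energyUnitBall hσ)).ne
      (lintegral_mono fun x =>
        iInf₂_le (f := fun k (_ : k ≤ 0) => potential G (ν k) x) 0 le_rfl)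
  obtain ⟨μ, hμ, hcap⟩ := exists_upperCap_iInf_le hG hpos hf hmeas hanti hfin
  have hμreg := hμ.1
  obtain ⟨c, hc⟩ : ∃ c : ℝ≥0, ∫⁻ x, ⨅ n, f n x ∂μ = c :=
    ⟨_, (ENNReal.coe_toNNReal (ne_top_of_le_ne_top (hfin μ hμ)
      (lintegral_mono fun x => iInf_le _ 0))).symm⟩
  have hmax : ∀ σ ∈ energyUnitBall G, ∫⁻ x, ⨅ n, f n x ∂σ ≤ c := fun σ hσ =>
    (lintegral_le_upperCap _ hσ).trans (hcap.trans_eq hc)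
  have hinfmeas : Measurable fun x => ⨅ n, f n x := .iInf hmeas
  have hae : ∀ σ ∈ energyUnitBall G, ∀ᵐ x ∂σ, ⨅ n, f n x ≤ potential G (c • μ) x := by
    intro σ hσ
    have := hσ.1
    refine ae_le_of_forall_setLIntegral_le_of_sigmaFinite hinfmeas fun s _ _ => ?_
    simp_rw [potential_smul]
    rw [lintegral_const_mul' _ _ ENNReal.coe_ne_top]
    exact lintegral_le_mul_lintegral_potential hG hpos hμ hc hmax
      -- Restrictions stay in the ball, so the integrated Euler inequality localizes to every
      -- measurable set.
      (restrict_mem_energyUnitBall hσ s)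
  have hω : c • μ ∈ finiteEnergy G := by
    refine ⟨inferInstance, ?_⟩
    rw [energy_smul]
    exact ENNReal.mul_lt_top (by simp) (hμ.2.trans_lt ENNReal.one_lt_top)
  -- The inequality `hae` for `μ` cannot be strict on a set of positive measure: the larger side has
  -- integral `c` times the energy of `μ`, hence at most `c`.
  have heq : ∀ᵐ x ∂μ, ⨅ n, f n x = potential G (c • μ) x := by
    refine ae_eq_of_ae_le_of_lintegral_le (hae μ hμ) (by simp [hc])
      (hG.measurable_potential _).aemeasurable ?_
    simp_rw [potential_smul]
    rw [lintegral_const_mul' _ _ ENNReal.coe_ne_top, hc]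
    exact mul_le_of_le_one_right' hμ.2
  refine ⟨c • μ, hω, fun n => hdom _ (hν n) _ hω ?_, ?_⟩
  · refine Measure.ae_smul_measure ?_ c
    filter_upwards [heq] with x hx
    rw [← hx, hinf]
    exact iInf_le _ n
  · simp_rw [← hinf]
    exact quasiEverywhere_iInf_le hG hpos hf hmeas hanti hfin
      (hG.lowerSemicontinuous_potential _) hae

theorem QuasiEverywhere.mono {P Q : X → Prop} (hP : QuasiEverywhere G P) (h : ∀ x, P x → Q x) :
    QuasiEverywhere G Q :=
  le_antisymm ((outerCap_mono fun x (hx : ¬ Q x) hPx => hx (h x hPx)).trans_eq hP) zero_le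

theorem QuasiUSC.congr {f k : X → ℝ≥0∞} (hf : QuasiUSC G f)
    (h : QuasiEverywhere G fun x => k x = f x) : QuasiUSC G k := by
  intro ε hε
  obtain ⟨V, hV, hfV⟩ := hf ε hε
  refine ⟨V ∪ {x | ¬ k x = f x}, ?_, fun x hx a hxa => ?_⟩
  · have h0 : outerCap G {x | ¬ k x = f x} = 0 := h
    exact (outerCap_union_le _ _).trans_lt (by rwa [h0, add_zero])
  · have heq : ∀ y ∈ (V ∪ {x | ¬ k x = f x})ᶜ, k y = f y := fun y hy =>
      not_not.1 fun hne => hy (Or.inr hne)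
    have hsub : (V ∪ {x | ¬ k x = f x})ᶜ ⊆ Vᶜ := compl_subset_compl.2 subset_union_left
    filter_upwards [nhdsWithin_mono x hsub (hfV x (hsub hx) a ((heq x hx).symm.trans_lt hxa)),
      self_mem_nhdsWithin] with y hy hyV
    exact (heq y hyV).trans_lt hy

end Envelope

end EnergyKernel

/-! ### Reduction of an arbitrary family to a sequence. -/

theorem mainTheorem11 {X : Type*} [TopologicalSpace X] [T2Space X] [LocallyCompactSpace X]
    [SecondCountableTopology X] [MeasurableSpace X] [BorelSpace X]
    (G : X → X → ℝ≥0∞) (hG : IsKernel G) (hcons : IsConsistent G) (hpos : IsPosDef G)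
    (hdom : DominationPrinciple G)
    {ι : Type*} [Nonempty ι] (m : ι → Measure X) (hm : ∀ i, m i ∈ finiteEnergy G) :
    (∃ μ ∈ finiteEnergy G,
      (∀ x, potential G μ x ≤ lscReg (fun y => ⨅ i, potential G (m i) y) x) ∧
      (∀ x, lscReg (fun y => ⨅ i, potential G (m i) y) x ≤ ⨅ i, potential G (m i) x) ∧
      QuasiEverywhere G (fun x => (⨅ i, potential G (m i) x) ≤ potential G μ x)) ∧
    QuasiUSC G (fun x => ⨅ i, potential G (m i) x) ∧
    QuasiEverywhere G (fun x =>
      (⨅ i, potential G (m i) x) = lscReg (fun y => ⨅ i, potential G (m i) y) x) := by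
  obtain ⟨s, hs⟩ := exists_seq_lowerSemicontinuous_le fun i => potential G (m i)
  obtain ⟨ω, hω, hle, hqe⟩ := exists_potential_le_of_seq hG hcons hpos hdom fun n => hm (s n)
  have hlsc := hG.lowerSemicontinuous_potential ω
  -- Being l.s.c., the potential of `ω` lies below the whole family as soon as it lies below the
  -- sequence.
  have hleInf : potential G ω ≤ fun y => ⨅ i, potential G (m i) y := fun x =>
    le_iInf fun i => hs _ hlsc hle i x
  have hqeInf : QuasiEverywhere G fun x => ⨅ i, potential G (m i) x ≤ potential G ω x :=
    hqe.mono fun x hx => (le_iInf fun n => iInf_le _ (s n)).trans hx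
  exact ⟨⟨ω, hω, le_lscReg hlsc hleInf, lscReg_le _, hqeInf⟩,
    (quasiUSC_of_mem_closure (hcons ω hω)).congr
      (hqeInf.mono fun x hx => le_antisymm hx (hleInf x)),
    hqeInf.mono fun x hx => le_antisymm (hx.trans (le_lscReg hlsc hleInf x)) (lscReg_le _ x)⟩
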